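/- Let the faces of the square grid be indexed by $\mathbb Z^2$, with the Manhattan distance $\mathrm{dist}$ (faces at distance $1$ are called adjacent), and fix a marked face $f_0$. A configuration $K$ assigns an integer weight $K_f$ to every face $f$. The firing moves (face-firing with marked face $f_0$) are the following. (i) If $f,g\neq f_0$ are adjacent and $K_f\ge K_g+2$, replace $K_f$ by $K_f-1$ and $K_g$ by $K_g+1$. (ii) If $g$ is adjacent to $f_0$ and $K_g<K_{f_0}$, replace $K_g$ by $K_g+1$. (iii) If $f$ is adjacent to $f_0$ and $K_f>K_{f_0}$, replace $K_f$ by $K_f-1$. The weight of $f_0$ never changes. A configuration is stable if no firing move is possible. Firing from $K$ can terminate in $L$ if $L$ is stable and is obtained from $K$ by finitely many (possibly zero) firing moves. Firing from $K$ terminates uniquely in $L$ if there is no infinite sequence of firing moves starting at $K$ and $L$ is the one and only configuration in which firing from $K$ can terminate. The weight of a configuration with finitely many nonzero entries is $\mathrm{weight}(K)=\sum_f K_f$. For integers $n,r\ge 0$, the pulse $K(n,r)$ has weight $n$ on every face $f$ with $\mathrm{dist}(f_0,f)\le r$ and weight $0$ on all other faces. The Aztec diamond $Az(n)$ has weight $n$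 on $f_0$ and weight $\max\{n-\mathrm{dist}(f_0,f)+1,\,0\}$ on every face $f\ne f_0$. **Theorem (Three-Regime Theorem for Flow-Firing).** Let $n,r\ge 0$ be integers. 1. If $r\le 1$, then firing from $K(n,r)$ terminates uniquely in $Az(n)$. 2. If $2\le r\le\lceil n/2\rceil$, then firing from $K(n,r)$ can terminate in $Az(n)$, but it can also terminate in some stable configuration different from $Az(n)$. 3. If $n\ge 2$ and $r>\lceil n/2\rceil$, then firing from $K(n,r)$ does not terminate uniquely: it can terminate in two different stable configurations. Moreover, if $n\ge 1$ and $r\ge\lceil n/\sqrt3\rceil+1$, then $\mathrm{weight}(K(n,r))>\mathrm{weight}(Az(n))$, and firing from $K(n,r)$ cannot terminate in $Az(n)$. -/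

import Mathlib

namespace FlowFiring

/-- A face (unit square) of the two-dimensional square grid, indexed by its integer coordinates. -/
abbrev Face : Type := ℤ × ℤ

/-- A face configuration: an integer weight on every face. -/
abbrev Config : Type := Face → ℤ

/-- The Manhattan distance between two faces; faces share an edge iff it equals `1`. -/
def faceDist (f g : Face) : ℕ := (f.1 - g.1).natAbs + (f.2 - g.2).natAbs

/-- `Fire f₀ K K'`: the configuration `K'` results from `K` by one face-firing move with marked
face `f₀`. The weight of the marked face never changes. -/
inductive Fire (f₀ : Face) : Config → Config → Prop
  /-- An ordinary face `f` fires towards an adjacent ordinary face `g` of weight smaller by at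
  least two: `f` loses one unit and `g` gains one unit. -/
  | ordinary (K : Config) (f g : Face) (hf : f ≠ f₀) (hg : g ≠ f₀) (hadj : faceDist f g = 1)
      (hw : K g + 2 ≤ K f) :
      Fire f₀ K (Function.update (Function.update K f (K f - 1)) g (K g + 1))
  /-- The marked face fires to an adjacent face `g` of smaller weight, which gains one unit. -/
  | fromMarked (K : Config) (g : Face) (hadj : faceDist f₀ g = 1) (hw : K g < K f₀) :
      Fire f₀ K (Function.update K g (K g + 1))
  /-- A face `f` adjacent to the marked face and of larger weight fires into the marked face,
  losing one unit. -/
  | toMarked (K : Config) (f : Face) (hadj : faceDist f f₀ = 1) (hw : K f₀ < K f) :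
      Fire f₀ K (Function.update K f (K f - 1))

/-- A configuration is stable if no firing move is possible. -/
def Stable (f₀ : Face) (K : Config) : Prop := ∀ K' : Config, ¬ Fire f₀ K K'

/-- Firing from `K` can terminate in `L`: some finite (possibly empty) sequence of firing moves
leads from `K` to `L`, and `L` is stable. -/
def CanTerminateIn (f₀ : Face) (K L : Config) : Prop :=
  Relation.ReflTransGen (Fire f₀) K L ∧ Stable f₀ L

/-- Firing from `K` terminates uniquely in `L`: there is no infinite sequence of firing moves
starting from `K`, and `L` is the one and only stable configuration in which firing from `K` can
terminate. -/
def TerminatesUniquelyIn (f₀ : Face) (K L : Config) : Prop :=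
  (¬ ∃ s : ℕ → Config, s 0 = K ∧ ∀ i : ℕ, Fire f₀ (s i) (s (i + 1))) ∧
    ∀ L' : Config, CanTerminateIn f₀ K L' ↔ L' = L

/-- The Aztec diamond `Az(n)` around the marked face `f₀`. -/
def aztec (f₀ : Face) (n : ℕ) : Config := fun f =>
  if f = f₀ then (n : ℤ) else max ((n : ℤ) - (faceDist f₀ f : ℤ) + 1) 0

/-- The pulse `K(n,r)` of height `n` and radius `r` around the marked face `f₀`. -/
def pulse (f₀ : Face) (n r : ℕ) : Config := fun f =>
  if faceDist f₀ f ≤ r then (n : ℤ) else 0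

/-- The total weight of a configuration of finite support. -/
noncomputable def weight (K : Config) : ℤ := ∑ᶠ f : Face, K f

end FlowFiring

open FlowFiring

/-! Firing is controlled by cones. A configuration of marked weight n below `cone f₀ n q`, q ≥ 1,
stays below it, because the cone is 1-Lipschitz and is at least n next to f₀ (`Barrier.fire`). Every
move lowers ∑ (K f - n)², so firing terminates. A nonnegative stable configuration of marked weight
n lies above Az(n), since weights drop by at most one per step away from the neighbours of f₀. As
Az(n) is the cone with q = 1, whatever gets below that cone must end in Az(n); this settles r ≤ 1.

Larger pulses are fired outward along disjoint rays. On a ray starting at distance s ≤ r the pulse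
weighs n(r+1-s) and the cone at least n(n+q-s) - n(n-1)/2, so 2r+1 ≤ 2q+n suffices for the cone to
dominate, whatever s is. Under this inequality all half-rows can be pushed below the cone
(`IsRays.exists_reach_le_cone`); q = 1 gives Az(n) for r ≤ ⌈n/2⌉. Conversely, a ray carrying more
than a cone can hold must overflow it (`Bounded.exists_reach_of_sum_lt`), and positive weights never
vanish again, so the overflow survives in the final configuration.

Non-uniqueness compares a contained run with an overflowing one. For odd n the inequality can be an
equality, and one unit taken from a neighbouring row causes the overflow. For even n there is slack:
it keeps one run below a notched cone, while a run along the upward column overflows the notch.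

Finally, no weight ever exceeds n, so nothing fires into f₀ and the total weight cannot decrease.
The last claim then follows from the two explicit weights. -/

lemma sum_comp_update {α : Type*} [DecidableEq α] (s : Finset α) (K : α → ℤ) (φ : ℤ → ℤ) {a : α}
    (v : ℤ) (ha : a ∈ s) :
    ∑ x ∈ s, φ (Function.update K a v x) = ∑ x ∈ s, φ (K x) + (φ v - φ (K a)) := by
  rw [← Finset.add_sum_erase s _ ha, ← Finset.add_sum_erase s (fun x => φ (K x)) ha]
  have : ∑ x ∈ s.erase a, φ (Function.update K a v x) = ∑ x ∈ s.erase a, φ (K x) :=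
    Finset.sum_congr rfl fun x hx => by
      rw [Function.update_of_ne (Finset.ne_of_mem_erase hx)]
  rw [this, Function.update_self]
  ring

namespace FlowFiring

lemma faceDist_self (f : Face) : faceDist f f = 0 := by simp [faceDist]

lemma faceDist_comm (f g : Face) : faceDist f g = faceDist g f := by
  unfold faceDist; omega

lemma faceDist_triangle (f g h : Face) : faceDist f h ≤ faceDist f g + faceDist g h := by
  unfold faceDist; omega

lemma faceDist_eq_zero {f g : Face} (h : faceDist f g = 0) : f = g := by
  unfold faceDist at h
  ext <;> omega

lemma ne_of_faceDist_pos {f g : Face} (h : 1 ≤ faceDist f g) : g ≠ f := by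
  rintro rfl
  rw [faceDist_self] at h
  omega

lemma faceDist_pos {f g : Face} (h : g ≠ f) : 1 ≤ faceDist f g := by
  by_contra h'
  exact h (faceDist_eq_zero (by omega)).symm

lemma exists_adj_closer {f₀ f : Face} {d : ℕ} (h : faceDist f₀ f = d + 1) :
    ∃ g, faceDist g f = 1 ∧ faceDist f₀ g = d := by
  obtain ⟨x, y⟩ := f₀
  obtain ⟨a, b⟩ := f
  simp only [faceDist] at h
  rcases lt_trichotomy a x with hx | hx | hx
  · exact ⟨(a + 1, b), by simp [faceDist], by simp only [faceDist]; omega⟩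
  · rcases lt_trichotomy b y with hy | hy | hy
    · exact ⟨(a, b + 1), by simp [faceDist], by simp only [faceDist]; omega⟩
    · omega
    · exact ⟨(a, b - 1), by simp [faceDist], by simp only [faceDist]; omega⟩
  · exact ⟨(a - 1, b), by simp [faceDist], by simp only [faceDist]; omega⟩

/-! ### Cones as barriers for firing -/

/-- The truncated cone of height `n` whose flat top has radius `q`. -/
def cone (f₀ : Face) (n q : ℤ) : Config := fun f => max (min n (n + q - faceDist f₀ f)) 0

lemma cone_nonneg (f₀ : Face) (n q : ℤ) (f : Face) : 0 ≤ cone f₀ n q f := le_max_right _ _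

lemma cone_le {n : ℤ} (hn : 0 ≤ n) (f₀ : Face) (q : ℤ) (f : Face) : cone f₀ n q f ≤ n := by
  unfold cone; omega

/-- A configuration that bounds every firing process from above once it bounds its start. -/
structure Barrier (f₀ : Face) (n : ℤ) (C : Config) : Prop where
  lipschitz : ∀ f g, f ≠ f₀ → g ≠ f₀ → faceDist f g = 1 → C f ≤ C g + 1
  le_adj : ∀ g, faceDist f₀ g = 1 → n ≤ C g

lemma barrier_cone (f₀ : Face) (n : ℤ) {q : ℤ} (hq : 1 ≤ q) : Barrier f₀ n (cone f₀ n q) where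
  lipschitz f g _ _ h := by
    have h1 := faceDist_triangle f₀ f g
    unfold cone; omega
  le_adj g h := by unfold cone; omega

lemma Fire.apply_marked {f₀ : Face} {K K' : Config} (h : Fire f₀ K K') : K' f₀ = K f₀ := by
  cases h with
  | ordinary f g hf hg => simp [Function.update_of_ne hf.symm, Function.update_of_ne hg.symm]
  | fromMarked g hadj => rw [Function.update_of_ne (ne_of_faceDist_pos hadj.ge).symm]
  | toMarked f hadj =>
    rw [faceDist_comm] at hadj
    rw [Function.update_of_ne (ne_of_faceDist_pos hadj.ge).symm]

lemma ne_of_adj {f g : Face} (h : faceDist f g = 1) : g ≠ f := ne_of_faceDist_pos h.ge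

lemma Fire.nonneg {f₀ : Face} {K K' : Config} (h : Fire f₀ K K') (hK : ∀ f, 0 ≤ K f) (x : Face) :
    0 ≤ K' x := by
  have hx := hK x
  cases h with
  | ordinary f g hf hg hadj hw =>
    have h1 := hK f
    have h2 := hK g
    simp only [Function.update_apply]
    split_ifs <;> omega
  | fromMarked g hadj hw =>
    have h2 := hK g
    simp only [Function.update_apply]
    split_ifs <;> omega
  | toMarked f hadj hw =>
    have h2 := hK f₀
    simp only [Function.update_apply]
    split_ifs <;> omega

/-- Among nonnegative configurations with maximal weight at the marked face, a positive weight
stays positive. -/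
lemma Fire.pos {f₀ : Face} {K K' : Config} (h : Fire f₀ K K') (hK : ∀ f, 0 ≤ K f)
    (hK' : ∀ f, K f ≤ K f₀) {x : Face} (hx : 1 ≤ K x) : 1 ≤ K' x := by
  cases h with
  | ordinary f g hf hg hadj hw =>
    have h1 := hK f
    have h2 := hK g
    simp only [Function.update_apply]
    split_ifs <;> omega
  | fromMarked g hadj hw =>
    have h2 := hK g
    simp only [Function.update_apply]
    split_ifs <;> omega
  | toMarked f hadj hw =>
    have h2 := hK' f
    omega

lemma Barrier.fire {f₀ : Face} {n : ℤ} {C K K' : Config} (hC : Barrier f₀ n C) (h : Fire f₀ K K')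
    (hn : K f₀ = n) (hK : ∀ f, K f ≤ C f) (x : Face) : K' x ≤ C x := by
  have hx := hK x
  cases h with
  | ordinary f g hf hg hadj hw =>
    have h1 := hK f
    have h2 := hC.lipschitz f g hf hg hadj
    simp only [Function.update_apply]
    split_ifs with h h'
    · subst h; omega
    · subst h'; omega
    · omega
  | fromMarked g hadj hw =>
    have h2 := hC.le_adj g hadj
    simp only [Function.update_apply]
    split_ifs with h
    · subst h; omega
    · omega
  | toMarked f hadj hw =>
    simp only [Function.update_apply]
    split_ifs with h
    · subst h; omega
    · omega

/-- Nonnegative configurations of marked weight `n` below the cone of radius `q`. -/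
structure Bounded (f₀ : Face) (n q : ℤ) (K : Config) : Prop where
  marked : K f₀ = n
  nonneg : ∀ f, 0 ≤ K f
  le : ∀ f, K f ≤ cone f₀ n q f

lemma Bounded.height_nonneg {f₀ : Face} {n q : ℤ} {K : Config} (h : Bounded f₀ n q K) : 0 ≤ n :=
  h.marked ▸ h.nonneg f₀

lemma Bounded.le_height {f₀ : Face} {n q : ℤ} {K : Config} (h : Bounded f₀ n q K) (f : Face) :
    K f ≤ n := (h.le f).trans (cone_le h.height_nonneg f₀ q f)

lemma Bounded.fire {f₀ : Face} {n q : ℤ} (hq : 1 ≤ q) {K K' : Config} (hK : Bounded f₀ n q K)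
    (h : Fire f₀ K K') : Bounded f₀ n q K' where
  marked := h.apply_marked.trans hK.marked
  nonneg := h.nonneg hK.nonneg
  le := (barrier_cone f₀ n hq).fire h hK.marked hK.le

lemma Bounded.reach {f₀ : Face} {n q : ℤ} (hq : 1 ≤ q) {K K' : Config} (hK : Bounded f₀ n q K)
    (h : Relation.ReflTransGen (Fire f₀) K K') : Bounded f₀ n q K' := by
  induction h with
  | refl => exact hK
  | tail _ h ih => exact ih.fire hq h

/-- This makes one positive face a certificate: it stays positive in every configuration reached
later, in particular in a terminal one. -/
lemma Bounded.reach_pos {f₀ : Face} {n q : ℤ} (hq : 1 ≤ q) {K K' : Config} (hK : Bounded f₀ n q K)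
    (h : Relation.ReflTransGen (Fire f₀) K K') {x : Face} (hx : 1 ≤ K x) : 1 ≤ K' x := by
  induction h with
  | refl => exact hx
  | tail h1 h ih =>
    have h2 := hK.reach hq h1
    exact h.pos h2.nonneg (fun f => h2.marked.symm ▸ h2.le_height f) ih

lemma Barrier.reach {f₀ : Face} {n : ℤ} {C K K' : Config} (hC : Barrier f₀ n C)
    (h : Relation.ReflTransGen (Fire f₀) K K') (hn : K f₀ = n) (hK : ∀ f, K f ≤ C f) :
    K' f₀ = n ∧ ∀ f, K' f ≤ C f := by
  induction h with
  | refl => exact ⟨hn, hK⟩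
  | tail _ h ih => exact ⟨h.apply_marked.trans ih.1, hC.fire h ih.1 ih.2⟩

/-! ### Termination by energy descent -/

/-- A square of faces centred at the marked face. -/
noncomputable def box (f₀ : Face) (R : ℤ) : Finset Face :=
  Finset.Icc (f₀.1 - R) (f₀.1 + R) ×ˢ Finset.Icc (f₀.2 - R) (f₀.2 + R)

lemma mem_box_of_faceDist_le {f₀ f : Face} {R : ℤ} (h : (faceDist f₀ f : ℤ) ≤ R) :
    f ∈ box f₀ R := by
  unfold faceDist at h
  simp only [box, Finset.mem_product, Finset.mem_Icc]
  omega

lemma Bounded.mem_box {f₀ : Face} {n q : ℤ} {K : Config} (hK : Bounded f₀ n q K) {f : Face}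
    (h : 1 ≤ K f) : f ∈ box f₀ (n + q) := by
  have := hK.le f
  unfold cone at this
  exact mem_box_of_faceDist_le (by omega)

/-- An ordinary move from weight a to weight b ≤ a - 2 changes the sum by 2 - 2(a - b) ≤ -2, and a
move involving f₀ brings one weight closer to n. The box contains both ends of each move because it
contains the support before and after. -/
lemma Bounded.energy_lt {f₀ : Face} {n q : ℤ} (hq : 1 ≤ q) {K K' : Config}
    (hK : Bounded f₀ n q K) (h : Fire f₀ K K') :
    ∑ f ∈ box f₀ (n + q), (K' f - n) ^ 2 < ∑ f ∈ box f₀ (n + q), (K f - n) ^ 2 := by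
  have hK' := hK.fire hq h
  have hn := hK.marked
  cases h with
  | ordinary f g hf hg hadj hw =>
    have h1 : f ∈ box f₀ (n + q) := hK.mem_box (by have := hK.nonneg g; omega)
    have h2 : g ∈ box f₀ (n + q) :=
      hK'.mem_box (by have := hK.nonneg g; rw [Function.update_self]; omega)
    rw [sum_comp_update _ _ (fun t => (t - n) ^ 2) _ h2,
      sum_comp_update _ _ (fun t => (t - n) ^ 2) _ h1, Function.update_of_ne (ne_of_adj hadj)]
    nlinarith
  | fromMarked g hadj hw =>
    have h2 : g ∈ box f₀ (n + q) :=
      hK'.mem_box (by have := hK.nonneg g; rw [Function.update_self]; omega)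
    rw [sum_comp_update _ _ (fun t => (t - n) ^ 2) _ h2]
    nlinarith
  | toMarked f hadj hw =>
    have h2 : f ∈ box f₀ (n + q) := hK.mem_box (by have := hK.nonneg f₀; omega)
    rw [sum_comp_update _ _ (fun t => (t - n) ^ 2) _ h2]
    nlinarith

lemma Bounded.not_infinite {f₀ : Face} {n q : ℤ} (hq : 1 ≤ q) {K : Config}
    (hK : Bounded f₀ n q K) :
    ¬ ∃ s : ℕ → Config, s 0 = K ∧ ∀ i : ℕ, Fire f₀ (s i) (s (i + 1)) := by
  rintro ⟨s, rfl, hs⟩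
  have hB : ∀ i, Bounded f₀ n q (s i) := fun i => by
    induction i with
    | zero => exact hK
    | succ i ih => exact ih.fire hq (hs i)
  set E : ℕ → ℤ := fun i => ∑ f ∈ box f₀ (n + q), (s i f - n) ^ 2 with hE
  have h1 : ∀ i : ℕ, E i + i ≤ E 0 := fun i => by
    induction i with
    | zero => simp
    | succ i ih =>
      have := (hB i).energy_lt hq (hs i)
      simp only [hE] at ih ⊢
      push_cast
      omega
  have h2 : 0 ≤ E ((E 0).toNat + 1) := Finset.sum_nonneg fun _ _ => sq_nonneg _
  have h3 := h1 ((E 0).toNat + 1)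
  push_cast at h3
  omega

/-- Any restricted firing process has a terminating run. -/
lemma Bounded.exists_normal {f₀ : Face} {n q : ℤ} (hq : 1 ≤ q) {R : Config → Config → Prop}
    (hR : ∀ K K', Bounded f₀ n q K → R K K' → Fire f₀ K K') {K : Config}
    (hK : Bounded f₀ n q K) :
    ∃ K', Relation.ReflTransGen R K K' ∧ ∀ K'', ¬ R K' K'' := by
  induction hE : (∑ f ∈ box f₀ (n + q), (K f - n) ^ 2).toNat using Nat.strong_induction_on
    generalizing K with
  | _ m ih =>
    by_cases h : ∃ K', R K K'
    · obtain ⟨K', h⟩ := h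
      have h1 := hK.energy_lt hq (hR _ _ hK h)
      have h2 : 0 ≤ ∑ f ∈ box f₀ (n + q), (K' f - n) ^ 2 :=
        Finset.sum_nonneg fun _ _ => sq_nonneg _
      obtain ⟨K'', h3, h4⟩ := ih _ (by omega) (hK.fire hq (hR _ _ hK h)) rfl
      exact ⟨K'', h3.head h, h4⟩
    · exact ⟨K, .refl, fun K' h' => h ⟨K', h'⟩⟩

lemma Bounded.exists_canTerminateIn {f₀ : Face} {n q : ℤ} (hq : 1 ≤ q) {K : Config}
    (hK : Bounded f₀ n q K) : ∃ L, CanTerminateIn f₀ K L :=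
  hK.exists_normal hq fun _ _ _ h => h

/-! ### Stable configurations and the Aztec diamond -/

lemma CanTerminateIn.of_reach {f₀ : Face} {K K' L : Config}
    (h : Relation.ReflTransGen (Fire f₀) K K') (hL : CanTerminateIn f₀ K' L) :
    CanTerminateIn f₀ K L := ⟨h.trans hL.1, hL.2⟩

lemma Stable.le_add_one {f₀ : Face} {L : Config} (h : Stable f₀ L) {f g : Face} (hf : f ≠ f₀)
    (hg : g ≠ f₀) (hadj : faceDist f g = 1) : L f ≤ L g + 1 := by
  by_contra hlt
  exact h _ (.ordinary L f g hf hg hadj (by omega))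

lemma Stable.le_of_adj {f₀ : Face} {L : Config} (h : Stable f₀ L) {g : Face}
    (hadj : faceDist f₀ g = 1) : L f₀ ≤ L g := by
  by_contra hlt
  exact h _ (.fromMarked L g hadj (by omega))

/-- Induction along a shortest path to f₀: the face next to f₀ has at least its weight, and each
further step loses at most one. -/
lemma Stable.le_apply {f₀ : Face} {L : Config} (h : Stable f₀ L) (d : ℕ) {f : Face}
    (hf : faceDist f₀ f = d + 1) : L f₀ - d ≤ L f := by
  induction d generalizing f with
  | zero => simpa using h.le_of_adj hf
  | succ d ih =>
    obtain ⟨g, h1, h2⟩ := exists_adj_closer hf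
    have h3 := ih h2
    have h4 := h.le_add_one (ne_of_faceDist_pos (f := f₀) (g := g) (by omega))
      (ne_of_faceDist_pos (f := f₀) (g := f) (by omega)) h1
    push_cast
    omega

lemma aztec_eq_cone (f₀ : Face) (n : ℕ) : aztec f₀ n = cone f₀ n 1 := by
  funext f
  unfold aztec cone
  split_ifs with h
  · subst h
    rw [faceDist_self]
    omega
  · have := faceDist_pos h
    omega

lemma Stable.eq_aztec {f₀ : Face} {n : ℕ} {L : Config} (h : Stable f₀ L)
    (hL : Bounded f₀ n 1 L) : L = aztec f₀ n := by
  funext f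
  refine le_antisymm (aztec_eq_cone f₀ n ▸ hL.le f) ?_
  unfold aztec
  split_ifs with hf
  · rw [hf, hL.marked]
  · have h1 := faceDist_pos hf
    have h2 := h.le_apply (faceDist f₀ f - 1) (f := f) (by omega)
    have h3 := hL.nonneg f
    rw [hL.marked] at h2
    omega

lemma Bounded.canTerminateIn_aztec {f₀ : Face} {n : ℕ} {K : Config} (hK : Bounded f₀ n 1 K) :
    CanTerminateIn f₀ K (aztec f₀ n) := by
  obtain ⟨L, hL⟩ := hK.exists_canTerminateIn le_rfl
  rwa [← hL.2.eq_aztec (hK.reach le_rfl hL.1)]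

lemma Bounded.terminatesUniquelyIn_aztec {f₀ : Face} {n : ℕ} {K : Config}
    (hK : Bounded f₀ n 1 K) : TerminatesUniquelyIn f₀ K (aztec f₀ n) := by
  refine ⟨hK.not_infinite le_rfl, fun L => ⟨fun hL => ?_, ?_⟩⟩
  · exact hL.2.eq_aztec (hK.reach le_rfl hL.1)
  · rintro rfl
    exact hK.canTerminateIn_aztec

lemma pulse_marked (f₀ : Face) (n r : ℕ) : pulse f₀ n r f₀ = n := by
  simp [pulse, faceDist_self]

lemma bounded_pulse (f₀ : Face) {n r : ℕ} {q : ℤ} (h : (r : ℤ) ≤ q) :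
    Bounded f₀ n q (pulse f₀ n r) where
  marked := pulse_marked f₀ n r
  nonneg f := by unfold pulse; split_ifs <;> omega
  le f := by unfold pulse cone; split_ifs <;> omega

/-! ### Firing along disjoint rays -/

/-- A family of pairwise disjoint rays of faces along which the distance from the marked face
grows by one at every step. -/
structure IsRays {ι : Type*} (f₀ : Face) (s : ι → ℕ) (ρ : ι → ℕ → Face) : Prop where
  dist : ∀ i j, faceDist f₀ (ρ i j) = s i + j
  pos : ∀ i, 1 ≤ s i
  adj : ∀ i j, faceDist (ρ i j) (ρ i (j + 1)) = 1
  inj : ∀ i i' j j', ρ i j = ρ i' j' → i = i'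

lemma IsRays.inj_iff {ι : Type*} {f₀ : Face} {s : ι → ℕ} {ρ : ι → ℕ → Face} (h : IsRays f₀ s ρ)
    {i i' : ι} {j j' : ℕ} : ρ i j = ρ i' j' ↔ i = i' ∧ j = j' := by
  refine ⟨fun he => ?_, by rintro ⟨rfl, rfl⟩; rfl⟩
  obtain rfl := h.inj _ _ _ _ he
  have h1 := h.dist i j
  rw [he, h.dist] at h1
  exact ⟨rfl, by omega⟩

lemma IsRays.ne_marked {ι : Type*} {f₀ : Face} {s : ι → ℕ} {ρ : ι → ℕ → Face}
    (h : IsRays f₀ s ρ) (i : ι) (j : ℕ) : ρ i j ≠ f₀ :=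
  ne_of_faceDist_pos (by rw [h.dist]; have := h.pos i; omega)

/-- Firing restricted to outward moves along rays, by faces exceeding the threshold `c`, and, if
`src` holds, to moves of the marked face towards the starting points of the rays. -/
inductive RayFire {ι : Type*} (f₀ : Face) (ρ : ι → ℕ → Face) (c : Config) (src : Prop) :
    Config → Config → Prop
  | along (K : Config) (i : ι) (j : ℕ) (hw : K (ρ i (j + 1)) + 2 ≤ K (ρ i j))
      (hc : c (ρ i j) < K (ρ i j)) :
      RayFire f₀ ρ c src K (Function.update (Function.update K (ρ i j) (K (ρ i j) - 1))
        (ρ i (j + 1)) (K (ρ i (j + 1)) + 1))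
  | source (K : Config) (i : ι) (hs : src) (hadj : faceDist f₀ (ρ i 0) = 1)
      (hw : K (ρ i 0) < K f₀) :
      RayFire f₀ ρ c src K (Function.update K (ρ i 0) (K (ρ i 0) + 1))

/-- Along every ray, the faces preceding a positive weight are at or above the threshold `c`. -/
def Guarded {ι : Type*} (ρ : ι → ℕ → Face) (c K : Config) : Prop :=
  ∀ i j k, k < j → 1 ≤ K (ρ i j) → c (ρ i k) ≤ K (ρ i k)

section

variable {ι : Type*} {f₀ : Face} {s : ι → ℕ} {ρ : ι → ℕ → Face} {c K K' : Config} {src : Prop}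
  {n q : ℤ}

lemma RayFire.fire (hρ : IsRays f₀ s ρ) (h : RayFire f₀ ρ c src K K') : Fire f₀ K K' := by
  cases h with
  | along i j hw hc =>
    exact .ordinary K _ _ (hρ.ne_marked _ _) (hρ.ne_marked _ _) (hρ.adj _ _) hw
  | source i hs hadj hw => exact .fromMarked K _ hadj hw

lemma RayFire.reach (hρ : IsRays f₀ s ρ) (h : Relation.ReflTransGen (RayFire f₀ ρ c src) K K') :
    Relation.ReflTransGen (Fire f₀) K K' := by
  induction h with
  | refl => exact .refl
  | tail _ h ih => exact ih.tail (h.fire hρ)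

lemma RayFire.apply_of_forall_ne (h : RayFire f₀ ρ c src K K') {f : Face} (hf : ∀ i j, f ≠ ρ i j) :
    K' f = K f := by
  cases h with
  | along i j hw hc => rw [Function.update_of_ne (hf _ _), Function.update_of_ne (hf _ _)]
  | source i hs hadj hw => rw [Function.update_of_ne (hf _ _)]

lemma RayFire.apply_zero_le (hρ : IsRays f₀ s ρ) (h : RayFire f₀ ρ c src K K') (hs : ¬ src)
    (i : ι) : K' (ρ i 0) ≤ K (ρ i 0) := by
  cases h with
  | along i' j hw hc =>
    rw [Function.update_of_ne (by rw [Ne, hρ.inj_iff]; omega), Function.update_apply]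
    split_ifs with h
    · rw [h]; omega
    · rfl
  | source i hs' hadj hw => exact absurd hs' hs

/-- A face fires only when strictly above its threshold, so it is still at or above it afterwards. A
newly reached face adds no new condition on earlier ones, since the firing face was already
positive. -/
lemma RayFire.guarded (hρ : IsRays f₀ s ρ) (h : RayFire f₀ ρ c src K K')
    (hK : Guarded ρ c K) (h0 : ∀ f, 0 ≤ K f) : Guarded ρ c K' := by
  intro i j k hkj hj
  cases h with
  | along i' j' hw hc =>
    have h1 := h0 (ρ i' (j' + 1))
    by_cases hi : i = i'
    · subst hi
      have hu : ∀ l, Function.update (Function.update K (ρ i j') (K (ρ i j') - 1))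
          (ρ i (j' + 1)) (K (ρ i (j' + 1)) + 1) (ρ i l) =
          if l = j' + 1 then K (ρ i (j' + 1)) + 1 else if l = j' then K (ρ i j') - 1
            else K (ρ i l) := fun l => by
        simp only [Function.update_apply, hρ.inj_iff, true_and]
      rw [hu] at hj ⊢
      have h2 := hK i j k hkj
      by_cases hj' : j = j' + 1
      · subst hj'
        rw [if_neg (by omega)]
        split_ifs with h3
        · subst h3; omega
        · exact hK i j' k (by omega) (by omega)
      · rw [if_neg hj'] at hj
        have h3 : 1 ≤ K (ρ i j) := by
          split_ifs at hj with h4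
          · subst h4; omega
          · exact hj
        have h4 := h2 h3
        split_ifs with h5 h6
        · subst h5; omega
        · subst h6; omega
        · exact h4
    · have hu : ∀ l l', ρ i l ≠ ρ i' l' := fun l l' h => hi (hρ.inj_iff.1 h).1
      rw [Function.update_of_ne (hu _ _), Function.update_of_ne (hu _ _)] at hj ⊢
      exact hK i j k hkj hj
  | source i' hs hadj hw =>
    have hne : ρ i j ≠ ρ i' 0 := by rw [Ne, hρ.inj_iff]; omega
    rw [Function.update_of_ne hne] at hj
    have h2 := hK i j k hkj hj
    rw [Function.update_apply]
    split_ifs with h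
    · rw [h] at h2 ⊢; omega
    · exact h2

open Classical in
lemma IsRays.sum_update (hρ : IsRays f₀ s ρ) (K : Config) (i i' : ι) {j N : ℕ} (v : ℤ)
    (hj : j < N) :
    ∑ k ∈ Finset.range N, Function.update K (ρ i j) v (ρ i' k) =
      ∑ k ∈ Finset.range N, K (ρ i' k) + if i = i' then v - K (ρ i j) else 0 := by
  split_ifs with h
  · subst h
    have h1 := sum_comp_update (Finset.range N) (fun k => K (ρ i k)) id v (Finset.mem_range.2 hj)
    simp only [id] at h1
    rw [← h1]
    refine Finset.sum_congr rfl fun k _ => ?_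
    simp only [Function.update_apply, hρ.inj_iff, true_and]
  · rw [add_zero]
    refine Finset.sum_congr rfl fun k _ => Function.update_of_ne ?_ _ _
    rw [Ne, hρ.inj_iff]
    exact fun h' => h h'.1.symm

open Classical in
-- Indices from N on lie outside the support, so every receiving face is counted: moves along rays
-- preserve each sum and source moves can only raise it.
lemma RayFire.sum_eq (hρ : IsRays f₀ s ρ) (hK : Bounded f₀ n q K) (hq : 1 ≤ q)
    (h : RayFire f₀ ρ c src K K') {N : ℕ} (hN : n + q ≤ N) (i : ι) :
    ∑ k ∈ Finset.range N, K (ρ i k) ≤ ∑ k ∈ Finset.range N, K' (ρ i k) ∧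
    (¬ src → ∑ k ∈ Finset.range N, K' (ρ i k) = ∑ k ∈ Finset.range N, K (ρ i k)) := by
  have hK' := hK.fire hq (h.fire hρ)
  have hlt : ∀ i j, 1 ≤ K' (ρ i j) → j < N := fun i j hj => by
    have h1 := hK'.le (ρ i j)
    unfold cone at h1
    rw [hρ.dist] at h1
    push_cast at h1
    omega
  cases h with
  | along i' j hw hc =>
    have hj : j + 1 < N := hlt i' (j + 1) (by
      rw [Function.update_self]
      have := hK.nonneg (ρ i' (j + 1))
      omega)
    have hne : ρ i' (j + 1) ≠ ρ i' j := by rw [Ne, hρ.inj_iff]; omega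
    rw [hρ.sum_update _ _ _ _ hj, hρ.sum_update _ _ _ _ (Nat.lt_of_succ_lt hj),
      Function.update_of_ne hne]
    split_ifs <;> refine ⟨?_, fun _ => ?_⟩ <;> omega
  | source i' hs hadj hw =>
    have hj : 0 < N := hlt i' 0 (by
      rw [Function.update_self]
      have := hK.nonneg (ρ i' 0)
      omega)
    rw [hρ.sum_update _ _ _ _ hj]
    refine ⟨?_, fun h => absurd hs h⟩
    split_ifs <;> omega

/-- A terminating run of ray firing, with its invariants. -/
lemma Bounded.exists_rayFire_normal (hq : 1 ≤ q) (hρ : IsRays f₀ s ρ) (c : Config) (src : Prop)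
    (hK : Bounded f₀ n q K) (hc : Guarded ρ c K) {N : ℕ} (hN : n + q ≤ N) :
    ∃ K', Relation.ReflTransGen (Fire f₀) K K' ∧ Bounded f₀ n q K' ∧ Guarded ρ c K' ∧
      (∀ f, (∀ i j, f ≠ ρ i j) → K' f = K f) ∧
      (¬ src → ∀ i, K' (ρ i 0) ≤ K (ρ i 0)) ∧
      (∀ i, ∑ k ∈ Finset.range N, K (ρ i k) ≤ ∑ k ∈ Finset.range N, K' (ρ i k)) ∧
      (¬ src → ∀ i, ∑ k ∈ Finset.range N, K' (ρ i k) = ∑ k ∈ Finset.range N, K (ρ i k)) ∧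
      (∀ i j, c (ρ i j) < K' (ρ i j) → K' (ρ i j) ≤ K' (ρ i (j + 1)) + 1) ∧
      (src → ∀ i, faceDist f₀ (ρ i 0) = 1 → n ≤ K' (ρ i 0)) := by
  obtain ⟨K', h1, h2⟩ := hK.exists_normal hq (R := RayFire f₀ ρ c src) fun _ _ _ h => h.fire hρ
  have hB := hK.reach hq (RayFire.reach hρ h1)
  refine ⟨K', RayFire.reach hρ h1, hB, ?_, ?_, ?_, ?_, ?_, ?_, ?_⟩
  · clear h2 hB
    induction h1 with
    | refl => exact hc
    | tail h1 h ih => exact h.guarded hρ ih (hK.reach hq (RayFire.reach hρ h1)).nonneg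
  · intro f hf
    clear h2 hB
    induction h1 with
    | refl => rfl
    | tail h1 h ih => rw [h.apply_of_forall_ne hf, ih]
  · intro hs i
    clear h2 hB
    induction h1 with
    | refl => rfl
    | tail h1 h ih => exact (h.apply_zero_le hρ hs i).trans ih
  · intro i
    clear h2 hB
    induction h1 with
    | refl => rfl
    | tail h1 h ih => exact ih.trans (h.sum_eq hρ (hK.reach hq (RayFire.reach hρ h1)) hq hN i).1
  · intro hs i
    clear h2 hB
    induction h1 with
    | refl => rfl
    | tail h1 h ih =>
      exact ((h.sum_eq hρ (hK.reach hq (RayFire.reach hρ h1)) hq hN i).2 hs).trans ih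
  · intro i j hj
    by_contra h
    exact h2 _ (.along K' i j (by omega) hj)
  · intro hs i hi
    by_contra h
    exact h2 _ (.source K' i hs hi (by rw [hB.marked]; omega))

end

/-! ### Comparing pulse and cone along a ray -/

/-- The total weight of the staircase with `M` steps truncated at height `n`. -/
lemma two_mul_sum_min (n : ℤ) (hn : 0 ≤ n) (M : ℕ) :
    2 * ∑ j ∈ Finset.range M, min n ((M : ℤ) - j) =
      2 * n * M - n * (n - 1) + max (n - M) 0 * (max (n - M) 0 - 1) := by
  have h : ∑ j ∈ Finset.range M, min n ((M : ℤ) - j) =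
      ∑ j ∈ Finset.range M, min n ((j : ℤ) + 1) := by
    rw [← Finset.sum_range_reflect]
    refine Finset.sum_congr rfl fun j hj => ?_
    rw [Finset.mem_range] at hj
    congr 1
    omega
  rw [h]
  clear h
  induction M with
  | zero => simp [max_eq_left hn]
  | succ M ih =>
    rw [Finset.sum_range_succ, mul_add, ih]
    push_cast
    rcases lt_or_ge (M : ℤ) n with h | h
    · rw [min_eq_right (by omega), max_eq_left (by omega), max_eq_left (by omega)]
      ring
    · rw [min_eq_left (by omega), max_eq_right (by omega), max_eq_right (by omega)]
      ring

/-- The weight of a cone along a ray. -/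
lemma IsRays.sum_cone {ι : Type*} {f₀ : Face} {s : ι → ℕ} {ρ : ι → ℕ → Face}
    (hρ : IsRays f₀ s ρ) {n : ℤ} (hn : 0 ≤ n) (q : ℤ) (i : ι) {M N : ℕ}
    (hM : n + q - s i ≤ M) (hM' : (M : ℤ) ≤ max (n + q - s i) 0) (hN : M ≤ N) :
    ∑ k ∈ Finset.range N, cone f₀ n q (ρ i k) = ∑ j ∈ Finset.range M, min n ((M : ℤ) - j) := by
  rw [← Finset.sum_subset (Finset.range_mono hN)]
  · refine Finset.sum_congr rfl fun k hk => ?_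
    rw [Finset.mem_range] at hk
    unfold cone
    rw [hρ.dist]
    push_cast
    omega
  · intro k _ hk
    rw [Finset.mem_range] at hk
    unfold cone
    rw [hρ.dist]
    push_cast
    omega

/-- The weight of a pulse along a ray. -/
lemma IsRays.sum_pulse {ι : Type*} {f₀ : Face} {s : ι → ℕ} {ρ : ι → ℕ → Face}
    (hρ : IsRays f₀ s ρ) (n r : ℕ) (i : ι) {N : ℕ} (hN : r < N) :
    ∑ k ∈ Finset.range N, pulse f₀ n r (ρ i k) = n * ((r + 1 - s i : ℕ) : ℤ) := by
  have h := hρ.pos i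
  rw [← Finset.sum_subset (Finset.range_mono (show r + 1 - s i ≤ N by omega)),
    Finset.sum_congr rfl (g := fun _ => (n : ℤ))]
  · simp [mul_comm]
  · intro k hk
    rw [Finset.mem_range] at hk
    unfold pulse
    rw [hρ.dist, if_pos (by omega)]
  · intro k _ hk
    rw [Finset.mem_range] at hk
    unfold pulse
    rw [hρ.dist, if_neg (by omega)]

lemma mul_pred_nonneg (t : ℤ) (ht : 0 ≤ t) : 0 ≤ t * (t - 1) := by
  rcases ht.eq_or_lt with rfl | h
  · simp
  · exact mul_nonneg ht (by omega)

section

variable {ι : Type*} {f₀ : Face} {s : ι → ℕ} {ρ : ι → ℕ → Face}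

/-- The start s i cancels: doubled, the difference is n(2q + n - 2r - 1) plus t(t - 1) ≥ 0, where t
is the number of steps missing from a cone cut off before full height. -/
lemma IsRays.sum_pulse_le_sum_cone (hρ : IsRays f₀ s ρ) {n r q N : ℕ} (h : 2 * r + 1 ≤ 2 * q + n)
    (hN : r < N) (hN' : n + q ≤ N) (i : ι) :
    ∑ k ∈ Finset.range N, pulse f₀ n r (ρ i k) ≤ ∑ k ∈ Finset.range N, cone f₀ n q (ρ i k) := by
  rcases le_or_gt (s i) r with hs | hs
  · have h1 := hρ.sum_cone (n := n) (by omega) q i (M := n + q - s i) (N := N)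
      (by omega) (by omega) (by omega)
    have h2 := two_mul_sum_min n (by omega) (n + q - s i)
    have h3 := mul_pred_nonneg (max ((n : ℤ) - (n + q - s i : ℕ)) 0) (le_max_right _ _)
    rw [hρ.sum_pulse n r i hN, h1]
    have h4 : (((n + q - s i : ℕ) : ℤ)) = n + q - s i := by omega
    have h5 : (((r + 1 - s i : ℕ) : ℤ)) = r + 1 - s i := by omega
    have h6 : (0 : ℤ) ≤ n * (2 * q + n - (2 * r + 1)) := mul_nonneg (by omega) (by omega)
    rw [h5]
    rw [h4] at h2 h3
    rw [h4]
    nlinarith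
  · rw [hρ.sum_pulse n r i hN, show r + 1 - s i = 0 by omega, Nat.cast_zero, mul_zero]
    exact Finset.sum_nonneg fun _ _ => cone_nonneg _ _ _ _

lemma IsRays.sum_pulse_lt_sum_cone (hρ : IsRays f₀ s ρ) {n r q N : ℕ} (hn : 1 ≤ n)
    (h : 2 * r + 1 < 2 * q + n) (hN : r < N) (hN' : n + q ≤ N) (i : ι) (hs' : s i < n + q) :
    ∑ k ∈ Finset.range N, pulse f₀ n r (ρ i k) < ∑ k ∈ Finset.range N, cone f₀ n q (ρ i k) := by
  rcases le_or_gt (s i) r with hs | hs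
  · have h1 := hρ.sum_cone (n := n) (by omega) q i (M := n + q - s i) (N := N)
      (by omega) (by omega) (by omega)
    have h2 := two_mul_sum_min n (by omega) (n + q - s i)
    have h3 := mul_pred_nonneg (max ((n : ℤ) - (n + q - s i : ℕ)) 0) (le_max_right _ _)
    rw [hρ.sum_pulse n r i hN, h1]
    have h4 : (((n + q - s i : ℕ) : ℤ)) = n + q - s i := by omega
    have h5 : (((r + 1 - s i : ℕ) : ℤ)) = r + 1 - s i := by omega
    have h6 : (0 : ℤ) < n * (2 * q + n - (2 * r + 1)) := mul_pos (by omega) (by omega)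
    rw [h5]
    rw [h4] at h2 h3
    rw [h4]
    nlinarith
  · rw [hρ.sum_pulse n r i hN, show r + 1 - s i = 0 by omega, Nat.cast_zero, mul_zero]
    refine Finset.sum_pos' (fun _ _ => cone_nonneg _ _ _ _)
      ⟨0, Finset.mem_range.2 (by omega), ?_⟩
    unfold cone
    rw [hρ.dist]
    push_cast
    omega

lemma IsRays.guarded_pulse (hρ : IsRays f₀ s ρ) {n r : ℕ} {c : Config} (hc : ∀ f, c f ≤ n) :
    Guarded ρ c (pulse f₀ n r) := by
  intro i j k hkj hj
  unfold pulse at hj ⊢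
  rw [hρ.dist] at hj ⊢
  rw [if_pos]
  · exact hc _
  · split_ifs at hj <;> omega

/-- Firing a pulse outward along rays brings it below a cone with at least the same weight. -/
lemma IsRays.exists_reach_le_cone (hρ : IsRays f₀ s ρ) (hcover : ∀ f, f ≠ f₀ → ∃ i j, f = ρ i j)
    {n r q N : ℕ} (hq : 1 ≤ q) (hqr : q ≤ r) (h : 2 * r + 1 ≤ 2 * q + n) (hN : r < N)
    (hN' : n + r ≤ N) :
    ∃ K, Relation.ReflTransGen (Fire f₀) (pulse f₀ n r) K ∧ Bounded f₀ n q K ∧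
      (∀ i, K (ρ i 0) ≤ pulse f₀ n r (ρ i 0)) ∧
      ∀ i, ∑ k ∈ Finset.range N, K (ρ i k) = ∑ k ∈ Finset.range N, pulse f₀ n r (ρ i k) := by
  have hn : (0 : ℤ) ≤ n := by omega
  obtain ⟨K, h1, hK, hG, -, h2, -, h3, h4, -⟩ :=
    (bounded_pulse f₀ (n := n) (le_refl (r : ℤ))).exists_rayFire_normal (by omega) hρ
      (cone f₀ n q) False (hρ.guarded_pulse (cone_le hn f₀ q)) (N := N) (by omega)
  refine ⟨K, h1, ⟨hK.marked, hK.nonneg, fun f => ?_⟩, h2 id, h3 id⟩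
  by_cases hf : f = f₀
  · subst hf
    rw [hK.marked]
    unfold cone
    rw [faceDist_self]
    omega
  obtain ⟨i, j, rfl⟩ := hcover f hf
  by_contra! hlt
  -- An excess over the cone propagates outward. A weight above the cone is at most n, so the
  -- plateau is already passed and the cone falls by one per step until it is 0, while the blocked
  -- ray falls by at most one.
  have key : ∀ k, cone f₀ n q (ρ i (j + k)) ≤ K (ρ i (j + k)) ∧
      (cone f₀ n q (ρ i (j + k)) = 0 ∨ cone f₀ n q (ρ i (j + k)) < K (ρ i (j + k))) := by
    intro k
    induction k with
    | zero => exact ⟨hlt.le, .inr hlt⟩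
    | succ k ih =>
      rcases ih.2 with h5 | h5
      · have h6 : cone f₀ n q (ρ i (j + (k + 1))) = 0 := by
          unfold cone at h5 ⊢
          rw [hρ.dist] at h5 ⊢
          push_cast at h5 ⊢
          omega
        exact ⟨h6 ▸ hK.nonneg _, .inl h6⟩
      · have h6 := h4 _ _ h5
        have h7 := hK.le_height (ρ i (j + k))
        rw [← add_assoc]
        unfold cone at h5 ⊢
        rw [hρ.dist] at h5 ⊢
        have h8 := hK.nonneg (ρ i (j + k + 1))
        push_cast at h5 ⊢
        omega
  have hj : 1 ≤ K (ρ i j) := (cone_nonneg f₀ n q (ρ i j)).trans_lt hlt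
  have hjN : j < N := by
    have h5 := hK.le (ρ i j)
    have h6 := hρ.pos i
    unfold cone at h5
    rw [hρ.dist] at h5
    push_cast at h5
    omega
  -- Faces before j are at or above the cone by the guard, those after it by `key`, and j is
  -- strictly above, contradicting conservation of the ray sum.
  have h5 : ∑ k ∈ Finset.range N, cone f₀ n q (ρ i k) < ∑ k ∈ Finset.range N, K (ρ i k) := by
    refine Finset.sum_lt_sum (fun k _ => ?_) ⟨j, Finset.mem_range.2 hjN, hlt⟩
    rcases lt_or_ge k j with h6 | h6
    · exact hG i j k h6 hj
    · have := (key (k - j)).1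
      rwa [Nat.add_sub_cancel' h6] at this
  have h6 := hρ.sum_pulse_le_sum_cone h hN (by omega) i
  rw [h3 id] at h5
  exact absurd h5 h6.not_gt

end

/-! ### Half-rows and the notched cone -/

/-- The horizontal rays: `(b, true)` points right and `(b, false)` points left in row `b`. -/
def rowRay (f₀ : Face) : ℤ × Bool → ℕ → Face
  | (b, true), j => (f₀.1 + (if b = 0 then 1 else 0) + j, f₀.2 + b)
  | (b, false), j => (f₀.1 - 1 - j, f₀.2 + b)

/-- The distance of the starting points of the horizontal rays from the marked face. -/
def rowStart : ℤ × Bool → ℕ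
  | (b, true) => b.natAbs + if b = 0 then 1 else 0
  | (b, false) => b.natAbs + 1

lemma isRays_rowRay (f₀ : Face) : IsRays f₀ rowStart (rowRay f₀) where
  dist := by
    rintro ⟨b, _ | _⟩ j <;> simp only [faceDist, rowRay, rowStart] <;> grind
  pos := by
    rintro ⟨b, _ | _⟩ <;> simp only [rowStart] <;> grind
  adj := by
    rintro ⟨b, _ | _⟩ j <;> simp only [faceDist, rowRay] <;> push_cast <;> omega
  inj := by
    rintro ⟨b, _ | _⟩ ⟨b', _ | _⟩ j j' h <;> simp only [rowRay, Prod.mk.injEq] at h ⊢ <;> grind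

lemma exists_eq_rowRay {f₀ f : Face} (h : f ≠ f₀) : ∃ i j, f = rowRay f₀ i j := by
  obtain ⟨x, y⟩ := f₀
  obtain ⟨a, b⟩ := f
  rw [Ne, Prod.mk.injEq] at h
  rcases lt_or_ge a x with h1 | h1
  · refine ⟨(b - y, false), (x - 1 - a).toNat, ?_⟩
    simp only [rowRay, Prod.mk.injEq]
    omega
  · by_cases h2 : b - y = 0
    · refine ⟨(b - y, true), (a - x - 1).toNat, ?_⟩
      simp only [rowRay, Prod.mk.injEq, if_pos h2]
      omega
    · refine ⟨(b - y, true), (a - x).toNat, ?_⟩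
      simp only [rowRay, Prod.mk.injEq, if_neg h2]
      omega

/-- The cone of radius `q`, lowered by one step on the upper half of the marked column, is a
barrier. -/
lemma barrier_notched_cone (f₀ : Face) (n : ℤ) {q : ℤ} (hq : 2 ≤ q) :
    Barrier f₀ n fun f => if f.1 = f₀.1 ∧ f₀.2 < f.2 then cone f₀ n (q - 1) f
      else cone f₀ n q f where
  lipschitz f g hf hg h := by
    obtain ⟨x, y⟩ := f₀
    obtain ⟨a, b⟩ := f
    obtain ⟨a', b'⟩ := g
    rw [Ne, Prod.mk.injEq] at hf hg
    simp only [faceDist] at h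
    simp only [cone, faceDist]
    split_ifs <;> omega
  le_adj g h := by
    unfold cone
    split_ifs <;> omega

/-- The strict inequality leaves slack on every half-row. After a second relaxation with threshold
0, a row starting in the upper column above the notch would carry at least the full cone weight,
which is too much. -/
lemma exists_canTerminateIn_notched (f₀ : Face) {n r q : ℕ} (hn : 1 ≤ n) (hq : 2 ≤ q)
    (hqr : q ≤ r) (h : 2 * r + 1 < 2 * q + n) :
    ∃ L, CanTerminateIn f₀ (pulse f₀ n r) L ∧ L (f₀.1, f₀.2 + (n + q - 1)) = 0 := by
  have hρ := isRays_rowRay f₀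
  obtain ⟨K, h1, hK, h2, h3⟩ := hρ.exists_reach_le_cone (fun f => exists_eq_rowRay)
    (N := n + r) (by omega) hqr h.le (by omega) le_rfl
  obtain ⟨K', h1', hK', -, -, h2', -, h3', h4, -⟩ :=
    hK.exists_rayFire_normal (by omega) hρ (fun _ => 0) False (fun _ _ _ _ _ => hK.nonneg _)
      (N := n + r) (by omega)
  have hcol : ∀ b : ℕ, 1 ≤ b → K' (f₀.1, f₀.2 + b) ≤ cone f₀ n (q - 1) (f₀.1, f₀.2 + b) := by
    intro b hb
    set i : ℤ × Bool := (b, true)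
    have hs : rowStart i = b := by simp [i, rowStart]; omega
    have hi : rowRay f₀ i 0 = (f₀.1, f₀.2 + b) := by simp [i, rowRay]; omega
    rw [← hi]
    by_contra! hlt
    have h5 := hK'.le (rowRay f₀ i 0)
    have h6 := hK'.le_height (rowRay f₀ i 0)
    have h7 : ∀ j : ℕ, (n : ℤ) + q - b - j ≤ K' (rowRay f₀ i j) := by
      intro j
      induction j with
      | zero =>
        unfold cone at hlt h5
        rw [hρ.dist, hs] at hlt h5
        push_cast at hlt h5 ⊢
        omega
      | succ j ih =>
        have h8 := h4 i j
        have h9 := hK'.nonneg (rowRay f₀ i j)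
        have h10 := hK'.nonneg (rowRay f₀ i (j + 1))
        push_cast
        omega
    have hs' : rowStart i < n + q := by
      unfold cone at hlt h5
      rw [hρ.dist] at hlt h5
      omega
    have h8 := hρ.sum_pulse_lt_sum_cone (N := n + r) hn h (by omega) (by omega) i hs'
    rw [← h3, ← h3' id] at h8
    refine absurd h8 (Finset.sum_le_sum fun j _ => ?_).not_gt
    have h9 := h7 j
    have h10 := hK'.nonneg (rowRay f₀ i j)
    unfold cone
    rw [hρ.dist, hs]
    push_cast
    omega
  obtain ⟨L, hL⟩ := hK'.exists_canTerminateIn (by omega)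
  refine ⟨L, hL.of_reach (h1.trans h1'), ?_⟩
  -- The notched cone bounds all later firing and vanishes on the column at distance n + q - 1.
  have h5 := ((barrier_notched_cone f₀ n (q := q) (by omega)).reach hL.1 hK'.marked fun f => by
    split_ifs with hf
    · have h6 := hcol (f.2 - f₀.2).toNat (by omega)
      rwa [show (f₀.1, f₀.2 + ((f.2 - f₀.2).toNat : ℤ)) = f by ext <;> simp <;> omega] at h6
    · exact hK'.le f).2 (f₀.1, f₀.2 + (n + q - 1))
  rw [if_pos (by constructor <;> dsimp only; omega)] at h5
  have h6 := (hK'.reach (by omega) hL.1).nonneg (f₀.1, f₀.2 + (n + q - 1))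
  simp only [cone, faceDist] at h5
  omega

/-! ### Overflowing a single ray -/

section

variable {f₀ : Face} {ρ : ℕ → Face} {K : Config} {n q : ℤ} {M N : ℕ}

/-- Firing along a single ray either puts weight on its face number `M` or leaves the ray below
the cone ending there. -/
lemma Bounded.exists_reach_singleRay (hq : 1 ≤ q) (hρ : IsRays f₀ (fun _ : Unit => 1) fun _ => ρ)
    (hK : Bounded f₀ n q K) (src : Prop) (hM : ∀ j, M < j → 1 ≤ K (ρ j) → 1 ≤ K (ρ M))
    (hN : n + q ≤ N) :
    ∃ K', Relation.ReflTransGen (Fire f₀) K K' ∧ Bounded f₀ n q K' ∧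
      (∀ j, M < j → 1 ≤ K' (ρ j) → 1 ≤ K' (ρ M)) ∧
      (∀ f, (∀ j, f ≠ ρ j) → K' f = K f) ∧
      ∑ k ∈ Finset.range N, K (ρ k) ≤ ∑ k ∈ Finset.range N, K' (ρ k) ∧
      (src → ∀ j : ℕ, j ≤ M → n - j ≤ K' (ρ j)) ∧
      (1 ≤ K' (ρ M) ∨ ∀ j, K' (ρ j) ≤ cone f₀ n (M + 1 - n) (ρ j)) := by
  obtain ⟨K', h1, hK', hG, h2, -, h3, -, h4, h5⟩ :=
    -- Threshold 1 at face M makes it keep its last unit, so weight beyond M forces weight on M.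
    hK.exists_rayFire_normal hq hρ (fun f => if f = ρ M then 1 else 0) src
      (fun _ j k hkj hj => by
        dsimp only
        split_ifs with h
        · obtain rfl := (hρ.inj_iff (i := ()) (i' := ())).1 h |>.2
          exact hM j hkj hj
        · exact hK.nonneg _) hN
  have hlt : ∀ j, j < M → 1 ≤ K' (ρ j) → K' (ρ j) ≤ K' (ρ (j + 1)) + 1 := fun j hj hj' => by
    refine h4 () j ?_
    rw [if_neg]
    · omega
    · intro h
      exact hj.ne ((hρ.inj_iff (i := ()) (i' := ())).1 h).2
  have hM' : ∀ j, M < j → 1 ≤ K' (ρ j) → 1 ≤ K' (ρ M) := fun j hj hj' => by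
    simpa using hG () j M hj hj'
  refine ⟨K', h1, hK', hM', fun f hf => h2 f fun _ => hf, h3 (), fun hs j hj => ?_, ?_⟩
  · induction j with
    | zero => simpa using h5 hs () (by simpa using hρ.dist () 0)
    | succ j ih =>
      have h6 := ih (by omega)
      have h7 := hlt j (by omega)
      have h8 := hK'.nonneg (ρ (j + 1))
      push_cast
      omega
  · by_cases h0 : 1 ≤ K' (ρ M)
    · exact .inl h0
    refine .inr fun j => ?_
    have hd : faceDist f₀ (ρ j) = 1 + j := hρ.dist () j
    have h6 : K' (ρ j) ≤ max ((M : ℤ) - j) 0 := by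
      rcases lt_or_ge M j with h | h
      · have := mt (hM' j h) h0
        omega
      · induction h' : M - j generalizing j with
        | zero =>
          obtain rfl : j = M := by omega
          omega
        | succ t ih =>
          have h7 := ih (j + 1) (hρ.dist () (j + 1)) (by omega) (by omega)
          have h8 := hlt j (by omega)
          push_cast at h7
          omega
    have h7 := hK'.le_height (ρ j)
    unfold cone
    rw [hd]
    push_cast
    omega

lemma Bounded.exists_reach_of_sum_lt (hq : 1 ≤ q)
    (hρ : IsRays f₀ (fun _ : Unit => 1) fun _ => ρ) (hK : Bounded f₀ n q K)
    (hM : ∀ j, M < j → 1 ≤ K (ρ j) → 1 ≤ K (ρ M)) (hN : n + q ≤ N)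
    (hsum : ∑ k ∈ Finset.range N, cone f₀ n (M + 1 - n) (ρ k) < ∑ k ∈ Finset.range N, K (ρ k)) :
    ∃ K', Relation.ReflTransGen (Fire f₀) K K' ∧ 1 ≤ K' (ρ M) := by
  obtain ⟨K', h1, -, -, -, h2, -, h3 | h3⟩ := hK.exists_reach_singleRay hq hρ False hM hN
  · exact ⟨K', h1, h3⟩
  · have := Finset.sum_le_sum fun k (_ : k ∈ Finset.range N) => h3 k
    omega

/-- A face of full height next to a saturated ray can overflow the ray. -/
lemma Bounded.exists_reach_of_spare (hq : 1 ≤ q)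
    (hρ : IsRays f₀ (fun _ : Unit => 1) fun _ => ρ) (hK : Bounded f₀ n q K)
    (hM : ∀ j, M < j → 1 ≤ K (ρ j) → 1 ≤ K (ρ M)) (hN : n + q ≤ N)
    (hsum : ∑ k ∈ Finset.range N, cone f₀ n (M + 1 - n) (ρ k) ≤ ∑ k ∈ Finset.range N, K (ρ k) ∨
      (M : ℤ) = n)
    {f : Face} {m : ℕ} (hm : m ≤ M) (hmN : m < N) (hmn : (M : ℤ) - m + 2 ≤ n) (hf : f ≠ f₀)
    (hfρ : ∀ j, f ≠ ρ j) (hadj : faceDist f (ρ m) = 1) (hKf : K f = n) :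
    ∃ K', Relation.ReflTransGen (Fire f₀) K K' ∧ 1 ≤ K' (ρ M) := by
  obtain ⟨K₁, h1, hK₁, hM₁, h2, h3, h4, h5 | h5⟩ :=
    hK.exists_reach_singleRay hq hρ ((M : ℤ) = n) hM hN
  · exact ⟨K₁, h1, h5⟩
  have hsum₁ : ∑ k ∈ Finset.range N, cone f₀ n (M + 1 - n) (ρ k) ≤
      ∑ k ∈ Finset.range N, K₁ (ρ k) := by
    rcases hsum with h6 | h6
    · exact h6.trans h3
    -- When M = n the marked face feeds the ray until it holds at least n - j at index j, exactly
    -- the cone.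
    · refine Finset.sum_le_sum fun j _ => ?_
      have h7 := h4 h6 j
      have h8 := hK₁.nonneg (ρ j)
      have hd : faceDist f₀ (ρ j) = 1 + j := hρ.dist () j
      unfold cone
      rw [hd]
      push_cast
      omega
  -- At index m the cone has height at most n - 2 by `hmn`, so `f`, untouched at weight n, can fire
  -- into the ray and push its sum above that of the cone.
  have hfire : Fire f₀ K₁ (Function.update (Function.update K₁ f (K₁ f - 1)) (ρ m)
      (K₁ (ρ m) + 1)) := by
    refine .ordinary K₁ f (ρ m) hf (hρ.ne_marked () m) hadj ?_
    rw [h2 f hfρ, hKf]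
    have h6 := h5 m
    have hd : faceDist f₀ (ρ m) = 1 + m := hρ.dist () m
    unfold cone at h6
    rw [hd] at h6
    push_cast at h6
    omega
  set K₂ := Function.update (Function.update K₁ f (K₁ f - 1)) (ρ m) (K₁ (ρ m) + 1) with hK₂
  have hval : ∀ j, K₂ (ρ j) = K₁ (ρ j) + if j = m then 1 else 0 := fun j => by
    have h6 : ρ j = ρ m ↔ j = m := by simpa using hρ.inj_iff (i := ()) (i' := ())
    simp only [hK₂, Function.update_apply, h6, if_neg (hfρ j).symm]
    split_ifs with h7
    · rw [h7]
    · rw [add_zero]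
  have hsum₂ : ∑ k ∈ Finset.range N, K₂ (ρ k) = ∑ k ∈ Finset.range N, K₁ (ρ k) + 1 := by
    simp only [hval, Finset.sum_add_distrib, Finset.sum_ite_eq', Finset.mem_range, if_pos hmN]
  obtain ⟨K₃, h6, h7⟩ := (hK₁.fire hq hfire).exists_reach_of_sum_lt hq hρ (M := M)
    (fun j hj hj' => by
      rw [hval, if_neg (by omega)] at hj'
      have := hM₁ j hj (by omega)
      rw [hval]
      split_ifs <;> omega) hN (by omega)
  exact ⟨K₃, (h1.tail hfire).trans h6, h7⟩

end

/-- The ray starting above the marked face and pointing to the right. -/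
def sideRay (f₀ : Face) (j : ℕ) : Face := (f₀.1 + j, f₀.2 + 1)

/-- The ray starting above the marked face and pointing upward. -/
def columnRay (f₀ : Face) (j : ℕ) : Face := (f₀.1, f₀.2 + 1 + j)

lemma isRays_sideRay (f₀ : Face) : IsRays f₀ (fun _ : Unit => 1) fun _ => sideRay f₀ where
  dist _ j := by simp only [faceDist, sideRay]; omega
  pos _ := le_rfl
  adj _ j := by simp only [faceDist, sideRay]; push_cast; omega
  inj _ _ _ _ _ := rfl

lemma isRays_columnRay (f₀ : Face) : IsRays f₀ (fun _ : Unit => 1) fun _ => columnRay f₀ where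
  dist _ j := by simp only [faceDist, columnRay]; omega
  pos _ := le_rfl
  adj _ j := by simp only [faceDist, columnRay]; push_cast; omega
  inj _ _ _ _ _ := rfl

lemma IsRays.pulse_pos_of_pos {f₀ : Face} {ρ : ℕ → Face}
    (hρ : IsRays f₀ (fun _ : Unit => 1) fun _ => ρ) (n r M : ℕ) (j : ℕ) (hj : M < j)
    (h : 1 ≤ pulse f₀ n r (ρ j)) : 1 ≤ pulse f₀ n r (ρ M) := by
  have h1 : faceDist f₀ (ρ j) = 1 + j := hρ.dist () j
  have h2 : faceDist f₀ (ρ M) = 1 + M := hρ.dist () M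
  unfold pulse at h ⊢
  rw [h1] at h
  rw [h2, if_pos]
  · split_ifs at h <;> omega
  · split_ifs at h <;> omega

lemma IsRays.two_mul_sum_cone {f₀ : Face} {ρ : ℕ → Face}
    (hρ : IsRays f₀ (fun _ : Unit => 1) fun _ => ρ) {n M N : ℕ} (hnM : n ≤ M) (hN : M ≤ N) :
    2 * ∑ k ∈ Finset.range N, cone f₀ n (M + 1 - n) (ρ k) = 2 * n * M - n * (n - 1) := by
  rw [hρ.sum_cone (n := n) (by omega) (M + 1 - n) () (M := M) (by push_cast; omega)
    (by push_cast; omega) hN, two_mul_sum_min _ (by omega), max_eq_right (by omega)]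
  ring

/-! ### Distinct terminal configurations -/

lemma exists_canTerminateIn_of_reach {f₀ : Face} {n r : ℕ} (hr : 1 ≤ r) {K : Config} {f : Face}
    (h : Relation.ReflTransGen (Fire f₀) (pulse f₀ n r) K) (hf : 1 ≤ K f) :
    ∃ L, CanTerminateIn f₀ (pulse f₀ n r) L ∧ 1 ≤ L f := by
  have hq : (1 : ℤ) ≤ r := by omega
  have hK := (bounded_pulse f₀ (n := n) (le_refl (r : ℤ))).reach hq h
  obtain ⟨L, hL⟩ := hK.exists_canTerminateIn hq
  exact ⟨L, hL.of_reach h, hK.reach_pos hq hL.1 hf⟩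

lemma exists_canTerminateIn_ne_aztec (f₀ : Face) {n r : ℕ} (hn : 2 ≤ n) (hr : 2 ≤ r) :
    ∃ L, L ≠ aztec f₀ n ∧ CanTerminateIn f₀ (pulse f₀ n r) L := by
  have hρ := isRays_sideRay f₀
  obtain ⟨K, h1, h2⟩ := (bounded_pulse f₀ (n := n) (le_refl (r : ℤ))).exists_reach_of_spare
    (by omega) hρ (hρ.pulse_pos_of_pos n r n) (N := n + r) (by omega) (.inr rfl)
    -- Index n of the ray is at distance n + 1, where Az(n) vanishes. The spare unit comes from
    -- distance 2, inside the pulse as r ≥ 2.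
    (f := (f₀.1 + 2, f₀.2)) (m := 2) hn (by omega) (by omega)
    (by rw [Ne, Prod.ext_iff]; dsimp only; omega)
    (fun j => by rw [Ne, Prod.ext_iff]; simp only [sideRay]; omega)
    (by simp only [faceDist, sideRay]; omega)
    (by rw [pulse, if_pos]; simp only [faceDist]; omega)
  obtain ⟨L, hL, h3⟩ := exists_canTerminateIn_of_reach (by omega) h1 h2
  refine ⟨L, ?_, hL⟩
  rintro rfl
  rw [aztec_eq_cone] at h3
  simp only [cone, sideRay, faceDist] at h3
  omega

lemma exists_two_of_odd (f₀ : Face) {n r q : ℕ} (hn : 2 ≤ n) (hq : 1 ≤ q)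
    (h : 2 * r + 1 = 2 * q + n) :
    ∃ L₁ L₂, L₁ ≠ L₂ ∧ CanTerminateIn f₀ (pulse f₀ n r) L₁ ∧
      CanTerminateIn f₀ (pulse f₀ n r) L₂ := by
  obtain ⟨K₁, h1, hK₁, -⟩ := (isRays_rowRay f₀).exists_reach_le_cone
    (fun f => exists_eq_rowRay) (n := n) (r := r) (N := n + r) hq (by omega) h.le (by omega) le_rfl
  obtain ⟨L₁, hL₁⟩ := hK₁.exists_canTerminateIn (by omega)
  have hρ := isRays_sideRay f₀
  have hsum := hρ.two_mul_sum_cone (n := n) (M := q + n - 1) (N := n + r) (by omega) (by omega)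
  obtain ⟨K₂, h2, h3⟩ := (bounded_pulse f₀ (n := n) (le_refl (r : ℤ))).exists_reach_of_spare
    (by omega) hρ (hρ.pulse_pos_of_pos n r (q + n - 1)) (N := n + r) (by omega) (.inl (by
      have h4 := hρ.sum_pulse n r () (N := n + r) (by omega)
      rw [h4]
      have h5 : ((q + n - 1 : ℕ) : ℤ) = q + n - 1 := by omega
      rw [h5] at hsum ⊢
      have h6 : (2 * r + 1 : ℤ) = 2 * q + n := by omega
      simp only [Nat.add_sub_cancel]
      nlinarith))
    -- The face at distance q + 1 ≤ r has full height, while the cone is n - 2 at the ray face above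
    -- it.
    (f := (f₀.1 + (q + 1), f₀.2)) (m := q + 1) (by omega) (by omega) (by omega)
    (by rw [Ne, Prod.ext_iff]; dsimp only; omega)
    (fun j => by rw [Ne, Prod.ext_iff]; simp only [sideRay]; omega)
    (by simp only [faceDist, sideRay]; push_cast; omega)
    (by rw [pulse, if_pos]; simp only [faceDist]; omega)
  obtain ⟨L₂, hL₂, h4⟩ := exists_canTerminateIn_of_reach (by omega) h2 h3
  refine ⟨L₁, L₂, ?_, hL₁.of_reach h1, hL₂⟩
  rintro rfl
  have h5 := (hK₁.reach (by omega) hL₁.1).le (sideRay f₀ (q + n - 1))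
  simp only [cone, sideRay, faceDist] at h4 h5
  omega

lemma exists_two_of_even (f₀ : Face) {n r q : ℕ} (hn : 2 ≤ n) (hq : 2 ≤ q)
    (h : 2 * r + 2 = 2 * q + n) :
    ∃ L₁ L₂, L₁ ≠ L₂ ∧ CanTerminateIn f₀ (pulse f₀ n r) L₁ ∧
      CanTerminateIn f₀ (pulse f₀ n r) L₂ := by
  obtain ⟨L₁, hL₁, h1⟩ := exists_canTerminateIn_notched f₀ (n := n) (r := r) (q := q) (by omega)
    hq (by omega) (by omega)
  have hρ := isRays_columnRay f₀
  have hsum := hρ.two_mul_sum_cone (n := n) (M := q + n - 2) (N := n + r) (by omega) (by omega)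
  obtain ⟨K₂, h2, h3⟩ := (bounded_pulse f₀ (n := n) (le_refl (r : ℤ))).exists_reach_of_sum_lt
    (by omega) hρ (hρ.pulse_pos_of_pos n r (q + n - 2)) (N := n + r) (by omega) (by
      have h4 := hρ.sum_pulse n r () (N := n + r) (by omega)
      rw [h4]
      have h5 : ((q + n - 2 : ℕ) : ℤ) = q + n - 2 := by omega
      rw [h5] at hsum ⊢
      have h6 : (2 * r + 2 : ℤ) = 2 * q + n := by omega
      simp only [Nat.add_sub_cancel]
      nlinarith)
  obtain ⟨L₂, hL₂, h4⟩ := exists_canTerminateIn_of_reach (by omega) h2 h3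
  refine ⟨L₁, L₂, ?_, hL₁, hL₂⟩
  rintro rfl
  rw [show (f₀.1, f₀.2 + ((n : ℤ) + q - 1)) = columnRay f₀ (q + n - 2) by
    ext <;> simp only [columnRay]; omega] at h1
  omega

lemma canTerminateIn_aztec_of_le (f₀ : Face) {n r : ℕ} (hr : 1 ≤ r) (h : 2 * r ≤ n + 1) :
    CanTerminateIn f₀ (pulse f₀ n r) (aztec f₀ n) := by
  obtain ⟨K, h1, hK, -⟩ := (isRays_rowRay f₀).exists_reach_le_cone
    (fun f => exists_eq_rowRay) (n := n) (N := n + r) le_rfl hr (by omega) (by omega) le_rfl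
  exact (Bounded.canTerminateIn_aztec (by exact_mod_cast hK)).of_reach h1

/-! ### Total weights -/

lemma sum_Icc_abs (k : ℕ) :
    ∑ a ∈ Finset.Icc (-(k : ℤ)) k, (2 * ((k : ℤ) - |a|) + 1) = 2 * k ^ 2 + 2 * k + 1 := by
  induction k with
  | zero => simp
  | succ k ih =>
    have h : Finset.Icc (-((k + 1 : ℕ) : ℤ)) (k + 1 : ℕ) =
        insert (-((k : ℤ) + 1)) (insert ((k : ℤ) + 1) (Finset.Icc (-(k : ℤ)) k)) := by
      ext a
      simp only [Finset.mem_insert, Finset.mem_Icc]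
      push_cast
      omega
    rw [h, Finset.sum_insert, Finset.sum_insert]
    · have h1 : ∀ a : ℤ, 2 * (((k + 1 : ℕ) : ℤ) - |a|) + 1 = (2 * ((k : ℤ) - |a|) + 1) + 2 :=
        fun a => by push_cast; ring
      have h2 : (((k : ℤ) + 1 - -k).toNat : ℤ) = 2 * k + 1 := by omega
      rw [Finset.sum_congr rfl fun a _ => h1 a, Finset.sum_add_distrib, ih, Finset.sum_const,
        Int.card_Icc, nsmul_eq_mul, abs_neg, abs_of_nonneg (by omega), h2]
      push_cast
      ring
    · simp
    · simp only [Finset.mem_insert, Finset.mem_Icc]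
      omega

/-- The number of faces within distance `k` of the marked face. -/
lemma sum_ball (f₀ : Face) (k : ℕ) {R : ℤ} (hR : k ≤ R) :
    ∑ f ∈ box f₀ R, (if faceDist f₀ f ≤ k then (1 : ℤ) else 0) = 2 * k ^ 2 + 2 * k + 1 := by
  obtain ⟨x, y⟩ := f₀
  rw [box, Finset.sum_product, ← sum_Icc_abs]
  have h1 : ∀ a ∈ Finset.Icc (x - R) (x + R), ∑ b ∈ Finset.Icc (y - R) (y + R),
      (if faceDist (x, y) (a, b) ≤ k then (1 : ℤ) else 0) =
      if |a - x| ≤ k then 2 * ((k : ℤ) - |a - x|) + 1 else 0 := by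
    intro a _
    rw [Finset.sum_ite, Finset.sum_const_zero, add_zero, Finset.sum_const, nsmul_eq_mul, mul_one]
    split_ifs with h
    · have h2 : (Finset.Icc (y - R) (y + R)).filter (fun b => faceDist (x, y) (a, b) ≤ k) =
          Finset.Icc (y - (k - |a - x|)) (y + (k - |a - x|)) := by
        ext b
        rw [Finset.mem_filter, Finset.mem_Icc, Finset.mem_Icc, faceDist]
        dsimp only
        rw [Int.abs_eq_natAbs] at h ⊢
        omega
      rw [h2, Int.card_Icc]
      omega
    · rw [Finset.filter_false_of_mem]
      · simp
      · intro b _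
        simp only [faceDist]
        rw [Int.abs_eq_natAbs] at h
        omega
  rw [Finset.sum_congr rfl h1, ← Finset.sum_filter]
  refine Finset.sum_nbij' (fun a => a - x) (fun a => a + x) ?_ ?_ ?_ ?_ ?_
  · intro a ha
    simp only [Finset.mem_filter, Finset.mem_Icc, abs_le] at ha ⊢
    omega
  · intro a ha
    simp only [Finset.mem_filter, Finset.mem_Icc, abs_le] at ha ⊢
    omega
  · intro a _; ring
  · intro a _; ring
  · intro a _; rfl

lemma Bounded.weight_eq {f₀ : Face} {n q : ℤ} {K : Config} (hK : Bounded f₀ n q K) :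
    weight K = ∑ f ∈ box f₀ (n + q), K f := by
  refine finsum_eq_sum_of_support_subset _ fun f hf => ?_
  have h1 := hK.nonneg f
  have h2 : K f ≠ 0 := hf
  exact hK.mem_box (by omega)

/-- Only a move into f₀ could lose weight, and it would need a face heavier than n. -/
lemma Bounded.weight_le {f₀ : Face} {n q : ℤ} (hq : 1 ≤ q) {K K' : Config}
    (hK : Bounded f₀ n q K) (h : Fire f₀ K K') : weight K ≤ weight K' := by
  have hK' := hK.fire hq h
  rw [hK.weight_eq, hK'.weight_eq]
  cases h with
  | ordinary f g hf hg hadj hw =>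
    have h1 : f ∈ box f₀ (n + q) := hK.mem_box (by have := hK.nonneg g; omega)
    have h2 : g ∈ box f₀ (n + q) :=
      hK'.mem_box (by have := hK.nonneg g; rw [Function.update_self]; omega)
    have h3 := sum_comp_update _ (Function.update K f (K f - 1)) id (K g + 1) h2
    have h4 := sum_comp_update _ K id (K f - 1) h1
    rw [Function.update_of_ne (ne_of_adj hadj)] at h3
    simp only [id] at h3 h4
    omega
  | fromMarked g hadj hw =>
    have h2 : g ∈ box f₀ (n + q) :=
      hK'.mem_box (by have := hK.nonneg g; rw [Function.update_self]; omega)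
    have h3 := sum_comp_update _ K id (K g + 1) h2
    simp only [id] at h3
    omega
  | toMarked f hadj hw =>
    have h1 := hK.le_height f
    have h2 := hK.marked
    omega

lemma Bounded.weight_le_of_reach {f₀ : Face} {n q : ℤ} (hq : 1 ≤ q) {K K' : Config}
    (hK : Bounded f₀ n q K) (h : Relation.ReflTransGen (Fire f₀) K K') :
    weight K ≤ weight K' := by
  induction h with
  | refl => rfl
  | tail h1 h ih => exact ih.trans ((hK.reach hq h1).weight_le hq h)

lemma weight_pulse (f₀ : Face) (n r : ℕ) :
    weight (pulse f₀ n r) = n * (2 * r ^ 2 + 2 * r + 1) := by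
  rw [(bounded_pulse f₀ (n := n) (le_refl (r : ℤ))).weight_eq,
    ← sum_ball f₀ r (R := n + r) (by omega), Finset.mul_sum]
  exact Finset.sum_congr rfl fun f _ => by rw [pulse, mul_ite, mul_one, mul_zero]

/-- The Aztec diamond is a stack of discs. -/
lemma aztec_eq_sum (f₀ : Face) (n : ℕ) (f : Face) :
    aztec f₀ n f = ∑ k ∈ Finset.range n, if faceDist f₀ f ≤ k + 1 then (1 : ℤ) else 0 := by
  rw [aztec_eq_cone, cone]
  induction n with
  | zero => simp
  | succ n ih =>
    rw [Finset.sum_range_succ, ← ih]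
    push_cast
    split_ifs <;> omega

lemma bounded_aztec (f₀ : Face) (n : ℕ) : Bounded f₀ n 1 (aztec f₀ n) where
  marked := by simp [aztec]
  nonneg f := by rw [aztec_eq_cone]; exact cone_nonneg _ _ _ _
  le f := by rw [aztec_eq_cone]

lemma three_mul_weight_aztec (f₀ : Face) (n : ℕ) :
    3 * weight (aztec f₀ n) = 2 * n * (n + 1) * (n + 2) + 3 * n := by
  rw [(bounded_aztec f₀ n).weight_eq]
  simp only [aztec_eq_sum]
  rw [Finset.sum_comm, Finset.sum_congr rfl (g := fun k : ℕ => 2 * ((k : ℤ) + 1) ^ 2 +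
    2 * (k + 1) + 1)]
  · induction n with
    | zero => simp
    | succ n ih =>
      rw [Finset.sum_range_succ, mul_add, ih]
      push_cast
      ring
  · intro k hk
    rw [Finset.mem_range] at hk
    rw [sum_ball f₀ (k + 1) (by push_cast; omega)]
    push_cast
    ring

lemma weight_aztec_lt_weight_pulse (f₀ : Face) {n r : ℕ} (hn : 1 ≤ n)
    (h : ⌈(n : ℝ) / √3⌉₊ + 1 ≤ r) : weight (aztec f₀ n) < weight (pulse f₀ n r) := by
  set m := ⌈(n : ℝ) / √3⌉₊
  have h1 : (n : ℝ) ≤ m * √3 := (div_le_iff₀ (by positivity)).1 (Nat.le_ceil _)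
  have h2 : n ^ 2 ≤ 3 * m ^ 2 := by
    have h3 : (n : ℝ) ^ 2 ≤ (m * √3) ^ 2 := pow_le_pow_left₀ (by positivity) h1 2
    rw [mul_pow, Real.sq_sqrt (by norm_num)] at h3
    have h4 : (n : ℝ) ^ 2 ≤ 3 * (m : ℝ) ^ 2 := by linarith
    exact_mod_cast h4
  have h3 : n ≤ 2 * m := by nlinarith
  have h4 : (n + 1) * (n + 2) < 3 * (r * (r + 1)) := by
    have : (m + 1) * (m + 2) ≤ r * (r + 1) := Nat.mul_le_mul h (by omega)
    nlinarith
  have h5 := three_mul_weight_aztec f₀ n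
  rw [weight_pulse]
  have h6 : (n : ℤ) * ((n + 1) * (n + 2)) < n * (3 * (r * (r + 1))) :=
    mul_lt_mul_of_pos_left (by exact_mod_cast h4) (by omega)
  nlinarith

lemma ceil_half (n : ℕ) : ⌈(n : ℝ) / 2⌉₊ = (n + 1) / 2 := by
  refine eq_of_forall_ge_iff fun c => ?_
  rw [Nat.ceil_le, div_le_iff₀ (by norm_num)]
  have h : (n : ℝ) ≤ c * 2 ↔ n ≤ c * 2 := by exact_mod_cast Iff.rfl
  rw [h]
  omega

end FlowFiring

open FlowFiring
theorem theorem1p1 (f₀ : Face) (n r : ℕ) :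
    (r ≤ 1 → TerminatesUniquelyIn f₀ (pulse f₀ n r) (aztec f₀ n)) ∧
    (2 ≤ r → r ≤ ⌈(n : ℝ) / 2⌉₊ →
      CanTerminateIn f₀ (pulse f₀ n r) (aztec f₀ n) ∧
      ∃ L : Config, L ≠ aztec f₀ n ∧ CanTerminateIn f₀ (pulse f₀ n r) L) ∧
    (2 ≤ n → ⌈(n : ℝ) / 2⌉₊ < r →
      ∃ L₁ L₂ : Config, L₁ ≠ L₂ ∧
        CanTerminateIn f₀ (pulse f₀ n r) L₁ ∧ CanTerminateIn f₀ (pulse f₀ n r) L₂) ∧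
    (1 ≤ n → ⌈(n : ℝ) / √3⌉₊ + 1 ≤ r →
      weight (aztec f₀ n) < weight (pulse f₀ n r) ∧
      ¬ CanTerminateIn f₀ (pulse f₀ n r) (aztec f₀ n)) := by
  rw [ceil_half]
  refine ⟨fun hr => ?_, fun hr hrn => ⟨?_, ?_⟩, fun hn hr => ?_, fun hn hr => ?_⟩
  · exact (bounded_pulse f₀ (by exact_mod_cast hr)).terminatesUniquelyIn_aztec
  · exact canTerminateIn_aztec_of_le f₀ (by omega) (by omega)
  · exact exists_canTerminateIn_ne_aztec f₀ (by omega) hr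
  -- With q = r - ⌈n/2⌉ + 1, the number 2q + n is 2r + 2 for even n and 2r + 1 for odd n. The
  -- hypothesis on r gives q ≥ 2, which the notch needs.
  · rcases Nat.even_or_odd' n with ⟨k, hk | hk⟩
    · exact exists_two_of_even f₀ (q := r - (n + 1) / 2 + 1) hn (by omega) (by omega)
    · exact exists_two_of_odd f₀ (q := r - (n + 1) / 2 + 1) hn (by omega) (by omega)
  · have hlt := weight_aztec_lt_weight_pulse f₀ hn hr
    refine ⟨hlt, fun h => hlt.not_ge ?_⟩
    exact (bounded_pulse f₀ (n := n) (le_refl (r : ℤ))).weight_le_of_reach (by omega) h.1
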